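/- Let $f$ be a nonconstant meromorphic function in the complex plane $\mathbb{C}$, and let $a_1,\ldots,a_5$ be five distinct points on the Riemann sphere $\mathbb{C}\cup\{\infty\}$. Then at least one of the equations $f(z)=a_j$, $1\le j\le 5$, has a simple solution $z\in\mathbb{C}$, that is, a solution of multiplicity one (a simple zero of $f-a_j$ if $a_j\neq\infty$, a simple pole of $f$ if $a_j=\infty$). -/

import Mathlib

open Filter Topology OnePoint

/-- The meromorphic function represented by `f` is constant. A meromorphic function is determined
by its values off a closed discrete set (the Lean values at poles and at removable singularities
carry no information), so being constant means agreeing with a constant off such a set. -/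
def IsConstantMeromorphic (f : ℂ → ℂ) : Prop :=
  ∃ c : ℂ, f =ᶠ[codiscrete ℂ] fun _ => c

/-- `z` is a simple solution of the equation `f z = a`, for `a` on the Riemann sphere `OnePoint ℂ`:
if `a = ∞`, then `z` is a simple pole of `f`; if `a` is finite, then `z` is a simple zero
of `f - a`. -/
def IsSimpleSolution (f : ℂ → ℂ) (a : OnePoint ℂ) (z : ℂ) : Prop :=
  match a with
  | ∞ => meromorphicOrderAt f z = -1
  | (b : ℂ) => meromorphicOrderAt (fun w => f w - b) z = 1

/-!
The proof is by negative curvature, in the style of the Ahlfors–Schwarz lemma, and uses no value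
distribution theory. Suppose that no `a j` has a simple solution. Let `s j` be the chordal
distance on the Riemann sphere to `a j`, normalized so that `s j ≤ 1`, and consider the conformal
metric on the sphere whose density `ρ` relative to the spherical metric satisfies
`ρ ^ 2 = ∏ j, (s j)⁻¹ * exp (2 / 15 * ∑ j, s j)`.
Each factor `(s j)⁻¹` produces a cone of angle `π` at `a j`. In units in which the spherical
metric contributes `-2` to the Laplacian of the logarithm of the squared density, each cone
contributes `1 / 2` away from its vertex; since `5 / 2 > 2`, five cones outweigh the positive
curvature of the sphere. The exponential factor, whose exponent has a Laplacian of size `1 / s j`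
near `a j`, keeps the curvature bounded away from zero at the cone points as well.

Let `u` be the logarithm of the squared density of the metric pulled back by `f`. It satisfies
`Δ u ≥ c * exp u` for some `c > 0` off a closed discrete set (`false_of_five_ramified`), and it is
bounded above near every point of that set precisely because a solution of `f z = a j` has
multiplicity at least two (`exists_eventually_sphDerivSq_div_chordal_le`). Such a function cannot
exist on the whole plane (`false_of_ultrahyperbolic`): on the disc of radius `r`, the maximum
principle compares `exp u` with the Poincaré metric, which tends to zero as `r` grows. The discrete
singularities are harmless because the maximum principle can be applied to
`u + ε * ∑ p, log (‖z - p‖ ^ 2)`, which tends to `-∞` there and has the same Laplacian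
(`ahlfors_disc`).

Laplacians are computed through second order expansions, `HasJet`.
-/

/-! ### Second order expansions and the Laplacian -/

/-- `φ` has at `z` the second order expansion
`φ (z + h) = φ z + re (A * h) + re (B * h ^ 2) + K * ‖h‖ ^ 2 + o(‖h‖ ^ 2)` for some `B`.
Here `A` is twice the Wirtinger derivative `∂φ`, and `K` is a quarter of the Laplacian. The
coefficient `B` is left unspecified, as it does not affect the Laplacian of a composition. -/
def HasJet (φ : ℂ → ℝ) (z A : ℂ) (K : ℝ) : Prop :=
  ∃ B : ℂ, (fun h : ℂ => φ (z + h) - φ z - (A * h).re - (B * h ^ 2).re - K * ‖h‖ ^ 2)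
    =o[𝓝 0] fun h : ℂ => ‖h‖ ^ 2

lemma isLittleO_norm_sq_norm {E : Type*} [SeminormedAddCommGroup E] :
    (fun h : E => ‖h‖ ^ 2) =o[𝓝 0] fun h : E => ‖h‖ := by
  have : (fun h : E => ‖h‖ ^ 2) =o[𝓝 0] fun h : E => ‖h‖ ^ 1 :=
    (Asymptotics.isLittleO_pow_pow (𝕜 := ℝ) (m := 1) (n := 2) (by norm_num)).comp_tendsto
      tendsto_norm_zero
  simpa using this

lemma isBigO_re_mul_pow (B : ℂ) (n : ℕ) :
    (fun h : ℂ => (B * h ^ n).re) =O[𝓝 0] fun h : ℂ => ‖h‖ ^ n :=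
  Asymptotics.IsBigO.of_bound ‖B‖ (Eventually.of_forall fun h => by
    rw [Real.norm_eq_abs, Real.norm_of_nonneg (by positivity), ← norm_pow, ← norm_mul]
    exact Complex.abs_re_le_norm _)

lemma tendsto_add_nhds_zero (z : ℂ) : Tendsto (fun h : ℂ => z + h) (𝓝 0) (𝓝 z) := by
  have : ContinuousAt (fun h : ℂ => z + h) 0 := by fun_prop
  simpa [ContinuousAt] using this

open Asymptotics in
lemma AnalyticAt.isLittleO_sub_taylor_two {𝕜 : Type*} [RCLike 𝕜] {g : 𝕜 → 𝕜} {z : 𝕜}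
    (hg : AnalyticAt 𝕜 g z) :
    (fun h : 𝕜 => g (z + h) - g z - deriv g z * h - deriv (deriv g) z / 2 * h ^ 2)
      =o[𝓝 0] fun h : 𝕜 => ‖h‖ ^ 2 := by
  have h1 := hg.hasFPowerSeriesAt.isBigO_sub_partialSum_pow 3
  have h2 : (fun h : 𝕜 => ‖h‖ ^ 3) =o[𝓝 0] fun h : 𝕜 => ‖h‖ ^ 2 := by
    refine (isLittleO_pow_pow (𝕜 := ℝ) (m := 2) (n := 3) (by norm_num)).comp_tendsto ?_
    exact tendsto_norm_zero
  refine (h1.trans_isLittleO h2).congr_left fun h => ?_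
  simp [FormalMultilinearSeries.partialSum, Finset.sum_range_succ, iteratedDeriv_succ,
    FormalMultilinearSeries.ofScalars, Nat.factorial]
  ring

namespace HasJet

open Asymptotics

variable {φ φ₁ φ₂ : ℂ → ℝ} {z A A₁ A₂ : ℂ} {K K₁ K₂ : ℝ}

lemma isBigO (h : HasJet φ z A K) : (fun h : ℂ => φ (z + h) - φ z) =O[𝓝 0] fun h : ℂ => ‖h‖ := by
  obtain ⟨B, hB⟩ := h
  have h1 : (fun h : ℂ => (A * h).re) =O[𝓝 0] fun h : ℂ => ‖h‖ := by
    simpa using isBigO_re_mul_pow A 1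
  have h3 : (fun h : ℂ => K * ‖h‖ ^ 2) =O[𝓝 0] fun h : ℂ => ‖h‖ ^ 2 :=
    (isBigO_refl _ _).const_mul_left K
  refine ((hB.isBigO.trans isLittleO_norm_sq_norm.isBigO).add
    (h1.add (((isBigO_re_mul_pow B 2).add h3).trans isLittleO_norm_sq_norm.isBigO))).congr_left
    fun h => ?_
  ring

lemma continuousAt (h : HasJet φ z A K) : ContinuousAt φ z := by
  have h0 : Tendsto (fun h : ℂ => φ (z + h) - φ z) (𝓝 0) (𝓝 0) :=
    h.isBigO.trans_tendsto tendsto_norm_zero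
  have h1 : Tendsto (fun w : ℂ => w - z) (𝓝 z) (𝓝 0) := by
    have : ContinuousAt (fun w : ℂ => w - z) z := by fun_prop
    simpa [ContinuousAt] using this
  have h2 := (h0.comp h1).add_const (φ z)
  simpa [ContinuousAt, Function.comp_def] using h2

lemma congr (h : HasJet φ₁ z A K) (he : φ₂ =ᶠ[𝓝 z] φ₁) : HasJet φ₂ z A K := by
  obtain ⟨B, hB⟩ := h
  refine ⟨B, hB.congr' ?_ EventuallyEq.rfl⟩
  filter_upwards [(tendsto_add_nhds_zero z).eventually he] with h hh
  rw [hh, he.eq_of_nhds]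

lemma congr_jet {K' : ℝ} (h : HasJet φ z A K) (hK : K = K') : HasJet φ z A K' := hK ▸ h

lemma const (c : ℝ) (z : ℂ) : HasJet (fun _ => c) z 0 0 :=
  ⟨0, by simp⟩

lemma add (h₁ : HasJet φ₁ z A₁ K₁) (h₂ : HasJet φ₂ z A₂ K₂) :
    HasJet (fun w => φ₁ w + φ₂ w) z (A₁ + A₂) (K₁ + K₂) := by
  obtain ⟨B₁, hB₁⟩ := h₁
  obtain ⟨B₂, hB₂⟩ := h₂
  refine ⟨B₁ + B₂, (hB₁.add hB₂).congr_left fun h => ?_⟩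
  simp only [add_mul, Complex.add_re]
  ring

lemma const_mul (c : ℝ) (h : HasJet φ z A K) :
    HasJet (fun w => c * φ w) z (c * A) (c * K) := by
  obtain ⟨B, hB⟩ := h
  refine ⟨c * B, (hB.const_mul_left c).congr_left fun h => ?_⟩
  simp only [mul_assoc, Complex.re_ofReal_mul]
  ring

lemma sum {ι : Type*} (s : Finset ι) {φ : ι → ℂ → ℝ} {A : ι → ℂ} {K : ι → ℝ}
    (h : ∀ i ∈ s, HasJet (φ i) z (A i) (K i)) :
    HasJet (fun w => ∑ i ∈ s, φ i w) z (∑ i ∈ s, A i) (∑ i ∈ s, K i) := by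
  classical
  induction s using Finset.induction_on with
  | empty => simpa using const 0 z
  | insert a s ha ih =>
    simp only [Finset.sum_insert ha]
    exact (h a (Finset.mem_insert_self a s)).add
      (ih fun i hi => h i (Finset.mem_insert_of_mem hi))

/-- The chain rule: the Laplacian of `ψ ∘ φ` is `ψ' Δφ + ψ'' |∇φ|²`, with `|∇φ| = ‖A‖`. -/
lemma comp_analyticAt {ψ : ℝ → ℝ} (h : HasJet φ z A K) (hψ : AnalyticAt ℝ ψ (φ z)) :
    HasJet (fun w => ψ (φ w)) z (deriv ψ (φ z) * A)
      (deriv ψ (φ z) * K + deriv (deriv ψ) (φ z) / 4 * ‖A‖ ^ 2) := by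
  have hO := h.isBigO
  obtain ⟨B, hB⟩ := h
  set d₁ := deriv ψ (φ z)
  set d₂ := deriv (deriv ψ) (φ z)
  refine ⟨d₁ * B + d₂ / 4 * A ^ 2, ?_⟩
  have ht : Tendsto (fun h : ℂ => φ (z + h) - φ z) (𝓝 0) (𝓝 0) :=
    hO.trans_tendsto tendsto_norm_zero
  have e1 : (fun h : ℂ => ψ (φ z + (φ (z + h) - φ z)) - ψ (φ z) - d₁ * (φ (z + h) - φ z)
      - d₂ / 2 * (φ (z + h) - φ z) ^ 2) =o[𝓝 0] fun h : ℂ => ‖h‖ ^ 2 := by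
    have := hψ.isLittleO_sub_taylor_two.comp_tendsto ht
    refine this.trans_isBigO ?_
    simpa [Function.comp_def] using hO.pow 2
  -- the square of the increment only sees the linear part of the jet
  have e2 : (fun h : ℂ => (φ (z + h) - φ z) ^ 2 - (A * h).re ^ 2)
      =o[𝓝 0] fun h : ℂ => ‖h‖ ^ 2 := by
    have hlin : (fun h : ℂ => (A * h).re) =O[𝓝 0] fun h : ℂ => ‖h‖ := by
      simpa using isBigO_re_mul_pow A 1
    have hq : (fun h : ℂ => (φ (z + h) - φ z) - (A * h).re) =o[𝓝 0] fun h : ℂ => ‖h‖ := by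
      have h2 : (fun h : ℂ => (B * h ^ 2).re + K * ‖h‖ ^ 2) =O[𝓝 0] fun h : ℂ => ‖h‖ ^ 2 :=
        (isBigO_re_mul_pow B 2).add ((isBigO_refl _ _).const_mul_left K)
      refine ((hB.isBigO.add h2).trans_isLittleO isLittleO_norm_sq_norm).congr_left fun h => ?_
      ring
    refine (hq.mul_isBigO (hO.add hlin)).congr (fun h => ?_) fun h => ?_ <;> ring
  refine ((e1.add (hB.const_mul_left d₁)).add (e2.const_mul_left (d₂ / 2))).congr_left
    fun h => ?_
  have hA : (A * h).re ^ 2 = (‖A‖ ^ 2 * ‖h‖ ^ 2 + (A ^ 2 * h ^ 2).re) / 2 := by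
    rw [← mul_pow, ← mul_pow, ← norm_mul, Complex.sq_norm, Complex.normSq_apply, sq (A * h),
      Complex.mul_re (A * h)]
    ring
  have hB' : ((d₁ * B + d₂ / 4 * A ^ 2) * h ^ 2).re
      = d₁ * (B * h ^ 2).re + d₂ / 4 * (A ^ 2 * h ^ 2).re := by
    have : (d₁ * B + d₂ / 4 * A ^ 2 : ℂ) * h ^ 2
        = d₁ * (B * h ^ 2) + ((d₂ / 4 : ℝ) : ℂ) * (A ^ 2 * h ^ 2) := by push_cast; ring
    rw [this, Complex.add_re, Complex.re_ofReal_mul, Complex.re_ofReal_mul]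
  rw [hB', hA, mul_assoc, Complex.re_ofReal_mul]
  ring_nf

lemma log (h : HasJet φ z A K) (h0 : 0 < φ z) :
    HasJet (fun w => Real.log (φ w)) z (A / φ z) (K / φ z - ‖A‖ ^ 2 / (4 * φ z ^ 2)) := by
  have := h.comp_analyticAt (analyticAt_log h0)
  simp only [Real.deriv_log', deriv_inv] at this
  convert this using 1
  · push_cast; ring
  · field_simp; ring

lemma exp (h : HasJet φ z A K) :
    HasJet (fun w => Real.exp (φ w)) z (Real.exp (φ z) * A)
      (Real.exp (φ z) * (K + ‖A‖ ^ 2 / 4)) := by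
  have := h.comp_analyticAt analyticAt_rexp
  simp only [Real.deriv_exp] at this
  convert this using 1
  ring

lemma norm_sq {g : ℂ → ℂ} (hg : AnalyticAt ℂ g z) :
    HasJet (fun w => ‖g w‖ ^ 2) z (2 * (starRingEnd ℂ (g z) * deriv g z)) (‖deriv g z‖ ^ 2) := by
  set c := deriv g z
  set e := deriv (deriv g) z / 2
  have ht := hg.isLittleO_sub_taylor_two
  refine ⟨2 * (starRingEnd ℂ (g z) * e), ?_⟩
  -- `R` collects the terms of order at least two in the increment of `g`
  set R : ℂ → ℂ := fun h => g (z + h) - g z - c * h with hR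
  have hRo : R =o[𝓝 0] fun h : ℂ => ‖h‖ := by
    have h2 : (fun h : ℂ => e * h ^ 2) =O[𝓝 0] fun h : ℂ => ‖h‖ ^ 2 :=
      IsBigO.of_bound ‖e‖ (Eventually.of_forall fun h => by simp)
    refine ((ht.isBigO.add h2).trans_isLittleO isLittleO_norm_sq_norm).congr_left fun h => ?_
    simp only [hR, c, e]; ring
  have hlin : (fun h : ℂ => 2 * (c * h)) =O[𝓝 0] fun h : ℂ => ‖h‖ :=
    IsBigO.of_bound (2 * ‖c‖) (Eventually.of_forall fun h => by simp [mul_assoc])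
  have e1 : (fun h : ℂ => (2 * (starRingEnd ℂ (g z)) *
      (g (z + h) - g z - c * h - e * h ^ 2)).re) =o[𝓝 0] fun h : ℂ => ‖h‖ ^ 2 := by
    refine IsBigO.trans_isLittleO ?_ (ht.const_mul_left (2 * (starRingEnd ℂ (g z))))
    exact IsBigO.of_bound 1 (Eventually.of_forall fun h => by
      rw [one_mul]; exact Complex.abs_re_le_norm _)
  have e2 : (fun h : ℂ => (starRingEnd ℂ (R h) * (2 * (c * h) + R h)).re)
      =o[𝓝 0] fun h : ℂ => ‖h‖ ^ 2 := by
    have hb : (fun h : ℂ => starRingEnd ℂ (R h)) =o[𝓝 0] fun h : ℂ => ‖h‖ :=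
      IsBigO.trans_isLittleO (IsBigO.of_bound 1 (Eventually.of_forall fun h => by simp)) hRo
    have := hb.mul_isBigO (hlin.add hRo.isBigO)
    refine (IsBigO.trans_isLittleO (IsBigO.of_bound 1 (Eventually.of_forall fun h => ?_))
      this).congr_right fun h => (sq _).symm
    rw [one_mul]; exact Complex.abs_re_le_norm _
  refine (e1.add e2).congr_left fun h => ?_
  have hg' : g (z + h) = g z + c * h + R h := by simp only [hR]; ring
  simp only [hg']
  rw [← mul_pow, ← norm_mul, Complex.sq_norm, Complex.sq_norm, Complex.sq_norm]
  simp only [Complex.normSq_apply, Complex.add_re, Complex.add_im, Complex.sub_re, Complex.sub_im,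
    Complex.mul_re, Complex.mul_im, Complex.conj_re, Complex.conj_im, Complex.re_ofNat,
    Complex.im_ofNat]
  ring

/-- The logarithm of the modulus of a holomorphic function is harmonic. -/
lemma log_norm_sq {g : ℂ → ℂ} (hg : AnalyticAt ℂ g z) (h0 : g z ≠ 0) :
    HasJet (fun w => Real.log (‖g w‖ ^ 2)) z (2 * (deriv g z / g z)) 0 := by
  have hn : ‖g z‖ ≠ 0 := norm_ne_zero_iff.2 h0
  convert (norm_sq hg).log (by positivity) using 1
  · have : ((‖g z‖ ^ 2 : ℝ) : ℂ) = starRingEnd ℂ (g z) * g z := by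
      rw [mul_comm, Complex.mul_conj, Complex.sq_norm]
    rw [this]
    have : starRingEnd ℂ (g z) ≠ 0 := by simpa using h0
    field_simp
  · simp only [norm_mul, RCLike.norm_conj, Complex.norm_ofNat]
    field_simp
    ring

/-- At a local maximum the Laplacian is nonpositive. -/
lemma nonpos_of_isLocalMax (h : HasJet φ z A K) (hm : IsLocalMax φ z) : K ≤ 0 := by
  obtain ⟨B, hB⟩ := h
  by_contra! hK
  have hB := hB.def (show (0 : ℝ) < K / 2 by linarith)
  obtain ⟨ε, hε, H⟩ := Metric.eventually_nhds_iff_ball.1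
    (hB.and ((tendsto_add_nhds_zero z).eventually hm))
  have key : ∀ h : ℂ, ‖h‖ = ε / 2 →
      (A * h).re + (B * h ^ 2).re + K / 2 * (ε / 2) ^ 2 ≤ 0 := by
    intro h hh
    obtain ⟨h2, h3⟩ := H h (by rw [mem_ball_zero_iff, hh]; linarith)
    rw [Real.norm_eq_abs, Real.norm_eq_abs, abs_of_nonneg (by positivity : 0 ≤ ‖h‖ ^ 2), hh] at h2
    have := (abs_le.1 h2).1
    linarith
  -- averaging over the four directions `1, I, -1, -I` kills the linear and the `B` terms
  have hn : ‖((ε / 2 : ℝ) : ℂ)‖ = ε / 2 := by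
    rw [Complex.norm_real, Real.norm_eq_abs, abs_of_pos (by positivity)]
  have k1 := key ((ε / 2 : ℝ) : ℂ) hn
  have k2 := key (((ε / 2 : ℝ) : ℂ) * Complex.I) (by simpa using hn)
  have k3 := key (-((ε / 2 : ℝ) : ℂ)) (by rw [norm_neg, hn])
  have k4 := key (-(((ε / 2 : ℝ) : ℂ) * Complex.I)) (by rw [norm_neg]; simpa using hn)
  have hI : (((ε / 2 : ℝ) : ℂ) * Complex.I) ^ 2 = -((ε / 2 : ℝ) : ℂ) ^ 2 := by
    rw [mul_pow, Complex.I_sq]; ring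
  rw [neg_sq, hI] at k4
  rw [hI] at k2
  rw [neg_sq] at k3
  simp only [mul_neg, Complex.neg_re] at k2 k3 k4
  have : 0 < K / 2 * (ε / 2) ^ 2 := by positivity
  linarith

end HasJet

/-! ### The Ahlfors–Schwarz lemma with discrete singularities -/

lemma mem_codiscrete_iff_forall_mem_nhdsNE {X : Type*} [TopologicalSpace X] {S : Set X} :
    S ∈ codiscrete X ↔ ∀ x, S ∈ 𝓝[≠] x := by
  simp [mem_codiscrete, disjoint_principal_right]

/-- Up to sign and constants, `log (r ^ 2 - ‖z‖ ^ 2)` is the logarithm of the density of the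
Poincaré metric of the disc of radius `r`. -/
lemma HasJet.log_poincare {r : ℝ} {z : ℂ} (hz : ‖z‖ < r) :
    ∃ A, HasJet (fun w : ℂ => Real.log (r ^ 2 - ‖w‖ ^ 2)) z A
      (-r ^ 2 / (r ^ 2 - ‖z‖ ^ 2) ^ 2) := by
  have hpos : 0 < r ^ 2 - ‖z‖ ^ 2 := by nlinarith [norm_nonneg z]
  have h1 := (HasJet.const (r ^ 2) z).add ((HasJet.norm_sq (analyticAt_id (z := z))).const_mul (-1))
  have h2 := h1.congr (φ₂ := fun w : ℂ => r ^ 2 - ‖w‖ ^ 2)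
    (Eventually.of_forall fun w => by simp; ring)
  have h3 := h2.log hpos
  refine ⟨_, h3.congr_jet ?_⟩
  simp
  field_simp
  ring

/-- The Ahlfors–Schwarz lemma on a disc, for a metric `exp u * |dz|²` of curvature bounded above by
a negative constant off a closed discrete set near whose points its density is bounded. -/
lemma ahlfors_disc {u : ℂ → ℝ} {G : Set ℂ} (hG : G ∈ codiscrete ℂ) {κ : ℝ} (hκ : 0 < κ)
    (hjet : ∀ z ∈ G, ∃ A K, HasJet u z A K ∧ κ * Real.exp (u z) ≤ K)
    (hbdd : ∀ z, ∃ M, ∀ᶠ w in 𝓝[≠] z, u w ≤ M) {r : ℝ} {z₀ : ℂ} (hz₀ : z₀ ∈ G)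
    (hr : ‖z₀‖ < r) :
    (r ^ 2 - ‖z₀‖ ^ 2) ^ 2 * Real.exp (u z₀) ≤ 2 / κ * r ^ 2 := by
  classical
  have hr0 : 0 < r := (norm_nonneg _).trans_lt hr
  have hGo : IsOpen G := (mem_codiscrete'.1 hG).1
  have hfin : (Metric.closedBall (0 : ℂ) r \ G).Finite :=
    (isCompact_closedBall (0 : ℂ) r).finite_sdiff_of_mem_codiscreteWithin
      (codiscreteWithin_mono (Set.subset_univ _) hG)
  set S := hfin.toFinset with hS
  have hSG : ∀ z ∈ G, ∀ p ∈ S, z - p ≠ 0 := by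
    intro z hz p hp h
    rw [sub_eq_zero] at h
    exact ((hfin.mem_toFinset).1 hp).2 (h ▸ hz)
  set T : ℂ → ℝ := fun z => ∏ p ∈ S, ‖z - p‖ ^ 2 with hT
  have hTnn : ∀ z, 0 ≤ T z := fun z => Finset.prod_nonneg fun p _ => by positivity
  have hTpos : ∀ z ∈ G, 0 < T z := fun z hz => Finset.prod_pos fun p hp => by
    have := norm_pos_iff.2 (hSG z hz p hp)
    positivity
  have hTc : Continuous T := by fun_prop
  set T₁ : ℝ := ∏ _p ∈ S, (2 * r) ^ 2 with hT₁
  have hT₁pos : 0 < T₁ := Finset.prod_pos fun p _ => by positivity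
  have hTle : ∀ z, ‖z‖ ≤ r → T z ≤ T₁ := by
    intro z hz
    refine Finset.prod_le_prod (fun p _ => by positivity) fun p hp => ?_
    have hp' : ‖p‖ ≤ r := by simpa using ((hfin.mem_toFinset).1 hp).1
    gcongr
    linarith [norm_sub_le z p]
  have key : ∀ ε : ℝ, 0 < ε → (r ^ 2 - ‖z₀‖ ^ 2) ^ 2 * Real.exp (u z₀) * T z₀ ^ ε
      ≤ 2 / κ * r ^ 2 * T₁ ^ ε := by
    intro ε hε
    -- the barrier `T z ^ ε` vanishes at the singularities, which makes `E` continuous and moves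
    -- its maximum to a point of `G` in the open disc
    set E : ℂ → ℝ := fun z =>
      if z ∈ G then (r ^ 2 - ‖z‖ ^ 2) ^ 2 * Real.exp (u z) * T z ^ ε else 0 with hE
    have hEG : ∀ z ∈ G, E z = (r ^ 2 - ‖z‖ ^ 2) ^ 2 * Real.exp (u z) * T z ^ ε :=
      fun z hz => if_pos hz
    have hcont : ContinuousOn E (Metric.closedBall 0 r) := by
      intro z hz
      refine ContinuousAt.continuousWithinAt ?_
      by_cases hzG : z ∈ G
      · have huc : ContinuousAt u z := by
          obtain ⟨A, K, h, -⟩ := hjet z hzG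
          exact h.continuousAt
        have : ContinuousAt (fun z => (r ^ 2 - ‖z‖ ^ 2) ^ 2 * Real.exp (u z) * T z ^ ε) z :=
          (ContinuousAt.mul (by fun_prop) (Real.continuous_exp.continuousAt.comp huc)).mul
            (hTc.continuousAt.rpow_const (Or.inr hε.le))
        refine this.congr ?_
        filter_upwards [hGo.mem_nhds hzG] with w hw
        exact (hEG w hw).symm
      · have hEz : E z = 0 := if_neg hzG
        have hTz : T z = 0 := Finset.prod_eq_zero (i := z)
          ((hfin.mem_toFinset).2 ⟨hz, hzG⟩) (by simp)
        obtain ⟨M, hM⟩ := hbdd z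
        rw [continuousAt_iff_punctured_nhds, hEz]
        have hlim : Tendsto (fun w => (r ^ 2 - ‖w‖ ^ 2) ^ 2 * Real.exp M * T w ^ ε) (𝓝[≠] z)
            (𝓝 0) := by
          have : ContinuousAt (fun w => (r ^ 2 - ‖w‖ ^ 2) ^ 2 * Real.exp M * T w ^ ε) z :=
            ContinuousAt.mul (by fun_prop) (hTc.continuousAt.rpow_const (Or.inr hε.le))
          have h2 := this.tendsto.mono_left (nhdsWithin_le_nhds (s := {z}ᶜ))
          simpa [hTz, Real.zero_rpow hε.ne'] using h2
        refine squeeze_zero' (Eventually.of_forall fun w => ?_) ?_ hlim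
        · by_cases hw : w ∈ G
          · rw [hEG w hw]
            exact mul_nonneg (by positivity) (Real.rpow_nonneg (hTnn w) _)
          · exact (if_neg hw).ge
        · filter_upwards [hM] with w hw
          by_cases hwG : w ∈ G
          · rw [hEG w hwG]
            have := Real.rpow_nonneg (hTnn w) ε
            gcongr
          · rw [show E w = 0 from if_neg hwG]
            exact mul_nonneg (by positivity) (Real.rpow_nonneg (hTnn w) _)
    obtain ⟨z₁, hz₁, hmax⟩ := (isCompact_closedBall (0 : ℂ) r).exists_isMaxOn
      ⟨0, by simpa using hr0.le⟩ hcont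
    have hE0 : 0 < E z₀ := by
      rw [hEG z₀ hz₀]
      have h1 : 0 < r ^ 2 - ‖z₀‖ ^ 2 := by nlinarith [norm_nonneg z₀]
      have h2 := Real.rpow_pos_of_pos (hTpos z₀ hz₀) ε
      positivity
    have hle : E z₀ ≤ E z₁ := hmax (by simpa using hr.le)
    have hE1 : 0 < E z₁ := hE0.trans_le hle
    have hz₁G : z₁ ∈ G := by
      by_contra h
      rw [show E z₁ = 0 from if_neg h] at hE1
      exact hE1.false
    have hz₁le : ‖z₁‖ ≤ r := by simpa using hz₁
    have hz₁r : ‖z₁‖ < r := by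
      refine lt_of_le_of_ne hz₁le fun h => ?_
      rw [hEG z₁ hz₁G, h] at hE1
      simp at hE1
    have hφ : 0 < r ^ 2 - ‖z₁‖ ^ 2 := by nlinarith [norm_nonneg z₁]
    obtain ⟨A, K, hu, hK⟩ := hjet z₁ hz₁G
    obtain ⟨A', hA'⟩ := HasJet.log_poincare hz₁r
    have hbar : HasJet (fun z => ∑ p ∈ S, Real.log (‖z - p‖ ^ 2)) z₁ _ _ :=
      HasJet.sum S fun p hp => HasJet.log_norm_sq (g := fun z => z - p) (by fun_prop)
        (hSG z₁ hz₁G p hp)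
    have hΦ := ((hA'.const_mul 2).add hu).add (hbar.const_mul ε)
    have hlmax : IsLocalMax (fun z => 2 * Real.log (r ^ 2 - ‖z‖ ^ 2) + u z
        + ε * ∑ p ∈ S, Real.log (‖z - p‖ ^ 2)) z₁ := by
      have hlog : ∀ z ∈ G, ‖z‖ < r → Real.log (E z) = 2 * Real.log (r ^ 2 - ‖z‖ ^ 2) + u z
          + ε * ∑ p ∈ S, Real.log (‖z - p‖ ^ 2) := by
        intro z hz hzr
        have h1 : 0 < r ^ 2 - ‖z‖ ^ 2 := by nlinarith [norm_nonneg z]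
        have h2 := hTpos z hz
        have h3 := Real.rpow_pos_of_pos h2 ε
        rw [hEG z hz, Real.log_mul (by positivity) h3.ne', Real.log_mul (by positivity)
          (Real.exp_pos _).ne', Real.log_exp, Real.log_pow, Real.log_rpow h2, hT,
          Real.log_prod fun p hp => pow_ne_zero 2 (norm_ne_zero_iff.2 (hSG z hz p hp))]
        simp
      have hball : ∀ᶠ z in 𝓝 z₁, ‖z‖ < r :=
        (continuous_norm.tendsto z₁).eventually (gt_mem_nhds hz₁r)
      filter_upwards [hball, hGo.mem_nhds hz₁G] with z hzr hzG
      rw [← hlog z hzG hzr, ← hlog z₁ hz₁G hz₁r]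
      refine Real.log_le_log ?_ (hmax (by simpa using hzr.le))
      have h1 : 0 < r ^ 2 - ‖z‖ ^ 2 := by nlinarith [norm_nonneg z]
      have h3 := Real.rpow_pos_of_pos (hTpos z hzG) ε
      rw [hEG z hzG]
      positivity
    have hneg := hΦ.nonpos_of_isLocalMax hlmax
    simp only [Finset.sum_const_zero, mul_zero, add_zero] at hneg
    have hb : (r ^ 2 - ‖z₁‖ ^ 2) ^ 2 * Real.exp (u z₁) ≤ 2 / κ * r ^ 2 := by
      have h1 : κ * Real.exp (u z₁) ≤ 2 * r ^ 2 / (r ^ 2 - ‖z₁‖ ^ 2) ^ 2 := by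
        calc _ ≤ K := hK
          _ ≤ _ := by rw [neg_div] at hneg; rw [mul_div_assoc]; linarith
      rw [le_div_iff₀ (by positivity)] at h1
      rw [div_mul_eq_mul_div, le_div_iff₀ hκ]
      linarith
    have hTT : T z₁ ^ ε ≤ T₁ ^ ε := Real.rpow_le_rpow (hTnn _) (hTle z₁ hz₁le) hε.le
    calc _ = E z₀ := (hEG z₀ hz₀).symm
      _ ≤ E z₁ := hle
      _ = _ := hEG z₁ hz₁G
      _ ≤ _ := mul_le_mul hb hTT (Real.rpow_nonneg (hTnn _) _) (by positivity)
  -- let `ε` tend to zero to remove the barrier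
  have hlim : ∀ t : ℝ, 0 < t → Tendsto (fun ε : ℝ => t ^ ε) (𝓝[>] 0) (𝓝 1) := by
    intro t ht
    have := (Real.continuousAt_const_rpow (b := 0) ht.ne').tendsto.mono_left
      (nhdsWithin_le_nhds (s := Set.Ioi 0))
    simpa using this
  have := le_of_tendsto_of_tendsto ((hlim _ (hTpos z₀ hz₀)).const_mul _)
    ((hlim _ hT₁pos).const_mul _) (eventually_nhdsWithin_of_forall fun ε hε => key ε hε)
  simpa using this

/-- The punctured plane `G` carries no conformal metric `exp u * |dz|²` of curvature bounded above by
a negative constant whose density is bounded near the punctures. -/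
theorem false_of_ultrahyperbolic {u : ℂ → ℝ} {G : Set ℂ} (hG : G ∈ codiscrete ℂ) {κ : ℝ}
    (hκ : 0 < κ) (hjet : ∀ z ∈ G, ∃ A K, HasJet u z A K ∧ κ * Real.exp (u z) ≤ K)
    (hbdd : ∀ z, ∃ M, ∀ᶠ w in 𝓝[≠] z, u w ≤ M) : False := by
  obtain ⟨z₀, hz₀⟩ : G.Nonempty := by
    have : (𝓝[≠] (0 : ℂ)).NeBot := inferInstance
    exact this.nonempty_of_mem (mem_codiscrete_iff_forall_mem_nhdsNE.1 hG 0)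
  have hlim : Tendsto (fun r : ℝ => r ^ 2 / 4 * Real.exp (u z₀)) atTop atTop :=
    Tendsto.atTop_mul_const (Real.exp_pos _)
      ((tendsto_pow_atTop two_ne_zero).atTop_div_const (by norm_num))
  obtain ⟨r, h1, h2⟩ := ((hlim.eventually_gt_atTop (2 / κ)).and
    (eventually_ge_atTop (2 * ‖z₀‖ + 1))).exists
  have hn := norm_nonneg z₀
  have hr0 : 0 < r := by linarith
  have h3 := ahlfors_disc hG hκ hjet hbdd hz₀ (show ‖z₀‖ < r by linarith)
  have h4 : r ^ 2 / 2 ≤ r ^ 2 - ‖z₀‖ ^ 2 := by nlinarith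
  have h5 : (r ^ 2 / 2) ^ 2 * Real.exp (u z₀) ≤ 2 / κ * r ^ 2 :=
    (by gcongr : _ ≤ (r ^ 2 - ‖z₀‖ ^ 2) ^ 2 * Real.exp (u z₀)).trans h3
  have h6 : r ^ 2 / 4 * Real.exp (u z₀) * r ^ 2 ≤ 2 / κ * r ^ 2 := by
    calc _ = (r ^ 2 / 2) ^ 2 * Real.exp (u z₀) := by ring
      _ ≤ _ := h5
  exact absurd (le_of_mul_le_mul_right h6 (by positivity)) (not_le.2 h1)

/-! ### The chordal distance -/

/-- The chordal distance on the Riemann sphere, of diameter one, from `w` to the point with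
homogeneous coordinates `[p : q]`, that is `p / q`, or `∞` if `q = 0`. The formula presupposes
coordinates with `‖p‖ ^ 2 + ‖q‖ ^ 2 = 1`. -/
noncomputable def chordal (p q w : ℂ) : ℝ := ‖q * w - p‖ / √(1 + ‖w‖ ^ 2)

/-- Lagrange's identity: the two summands are, up to the factor `1 + ‖w‖ ^ 2`, the squared chordal
distances of `w` from `[p : q]` and from its antipode. -/
lemma norm_sq_add_norm_sq_of_unit {p q : ℂ} (h : ‖p‖ ^ 2 + ‖q‖ ^ 2 = 1) (w : ℂ) :
    ‖q + p * starRingEnd ℂ w‖ ^ 2 + ‖q * w - p‖ ^ 2 = 1 + ‖w‖ ^ 2 := by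
  have : ‖q + p * starRingEnd ℂ w‖ ^ 2 + ‖q * w - p‖ ^ 2
      = (‖p‖ ^ 2 + ‖q‖ ^ 2) * (1 + ‖w‖ ^ 2) := by
    simp only [Complex.sq_norm, Complex.normSq_apply, Complex.add_re, Complex.add_im,
      Complex.sub_re, Complex.sub_im, Complex.mul_re, Complex.mul_im, Complex.conj_re,
      Complex.conj_im]
    ring
  rw [this, h, one_mul]

lemma chordal_nonneg (p q w : ℂ) : 0 ≤ chordal p q w := by unfold chordal; positivity

lemma chordal_pos {p q w : ℂ} (h : q * w - p ≠ 0) : 0 < chordal p q w := by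
  have := norm_pos_iff.2 h
  unfold chordal
  positivity

lemma chordal_sq (p q w : ℂ) : chordal p q w ^ 2 = ‖q * w - p‖ ^ 2 / (1 + ‖w‖ ^ 2) := by
  rw [chordal, div_pow, Real.sq_sqrt (by positivity)]

lemma chordal_le_one {p q : ℂ} (h : ‖p‖ ^ 2 + ‖q‖ ^ 2 = 1) (w : ℂ) : chordal p q w ≤ 1 := by
  have h1 : chordal p q w ^ 2 ≤ 1 := by
    rw [chordal_sq, div_le_one (by positivity), ← norm_sq_add_norm_sq_of_unit h w]
    linarith [sq_nonneg ‖q + p * starRingEnd ℂ w‖]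
  exact (sq_le_one_iff₀ (chordal_nonneg p q w)).1 h1

/-- The triangle inequality for the chordal distance: the left side is the distance between
`[p₁ : q₁]` and `[p₂ : q₂]`. -/
lemma norm_sub_le_chordal_add {p₁ q₁ p₂ q₂ : ℂ} (h₁ : ‖p₁‖ ^ 2 + ‖q₁‖ ^ 2 = 1)
    (h₂ : ‖p₂‖ ^ 2 + ‖q₂‖ ^ 2 = 1) (w : ℂ) :
    ‖p₁ * q₂ - p₂ * q₁‖ ≤ chordal p₁ q₁ w + chordal p₂ q₂ w := by
  have hpos : 0 < √(1 + ‖w‖ ^ 2) := by positivity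
  have hsq : √(1 + ‖w‖ ^ 2) * √(1 + ‖w‖ ^ 2) = 1 + ‖w‖ ^ 2 := Real.mul_self_sqrt (by positivity)
  have hb : ∀ {p q : ℂ}, ‖p‖ ^ 2 + ‖q‖ ^ 2 = 1 →
      ‖q + p * starRingEnd ℂ w‖ ≤ √(1 + ‖w‖ ^ 2) := fun {p q} h => by
    refine Real.le_sqrt_of_sq_le ?_
    rw [← norm_sq_add_norm_sq_of_unit h w]
    linarith [sq_nonneg ‖q * w - p‖]
  have hc : ((1 + ‖w‖ ^ 2 : ℝ) : ℂ) = 1 + w * starRingEnd ℂ w := by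
    rw [Complex.mul_conj, Complex.normSq_eq_norm_sq]; push_cast; rfl
  have hid : (p₁ * q₂ - p₂ * q₁) * ((1 + ‖w‖ ^ 2 : ℝ) : ℂ)
      = (q₁ + p₁ * starRingEnd ℂ w) * (q₂ * w - p₂)
        - (q₂ + p₂ * starRingEnd ℂ w) * (q₁ * w - p₁) := by
    rw [hc]; ring
  have hle : ‖p₁ * q₂ - p₂ * q₁‖ * (1 + ‖w‖ ^ 2)
      ≤ √(1 + ‖w‖ ^ 2) * (‖q₁ * w - p₁‖ + ‖q₂ * w - p₂‖) := by
    calc _ = ‖(p₁ * q₂ - p₂ * q₁) * ((1 + ‖w‖ ^ 2 : ℝ) : ℂ)‖ := by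
          rw [norm_mul, Complex.norm_real, Real.norm_of_nonneg (by positivity)]
      _ ≤ ‖q₁ + p₁ * starRingEnd ℂ w‖ * ‖q₂ * w - p₂‖
          + ‖q₂ + p₂ * starRingEnd ℂ w‖ * ‖q₁ * w - p₁‖ := by
          rw [hid, ← norm_mul, ← norm_mul]; exact norm_sub_le _ _
      _ ≤ √(1 + ‖w‖ ^ 2) * ‖q₂ * w - p₂‖ + √(1 + ‖w‖ ^ 2) * ‖q₁ * w - p₁‖ := by
          gcongr
          · exact hb h₁
          · exact hb h₂
      _ = _ := by ring
  rw [chordal, chordal, ← add_div, le_div_iff₀ hpos]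
  refine le_of_mul_le_mul_left ?_ hpos
  calc _ = ‖p₁ * q₂ - p₂ * q₁‖ * (√(1 + ‖w‖ ^ 2) * √(1 + ‖w‖ ^ 2)) := by ring
    _ ≤ _ := by rw [hsq]; exact hle

/-- The square of the spherical derivative of `f`. -/
noncomputable def sphDerivSq (f : ℂ → ℂ) (z : ℂ) : ℝ := ‖deriv f z‖ ^ 2 / (1 + ‖f z‖ ^ 2) ^ 2

section

variable {f : ℂ → ℂ} {z p q : ℂ}

lemma HasJet.log_one_add_norm_sq (hf : AnalyticAt ℂ f z) :
    HasJet (fun w => Real.log (1 + ‖f w‖ ^ 2)) z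
      (2 * (starRingEnd ℂ (f z) * deriv f z) / (1 + ‖f z‖ ^ 2 : ℝ)) (sphDerivSq f z) := by
  have h := ((HasJet.const 1 z).add (HasJet.norm_sq hf)).log
    (show (0 : ℝ) < 1 + ‖f z‖ ^ 2 by positivity)
  convert h using 1
  · rw [zero_add]
  · simp only [zero_add, norm_mul, RCLike.norm_conj, Complex.norm_ofNat, sphDerivSq]
    field_simp
    ring

lemma HasJet.log_chordal (hf : AnalyticAt ℂ f z) (hpq : ‖p‖ ^ 2 + ‖q‖ ^ 2 = 1)
    (h0 : q * f z - p ≠ 0) :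
    ∃ A, HasJet (fun w => Real.log (chordal p q (f w))) z A (-sphDerivSq f z / 2) ∧
      ‖A‖ ^ 2 = sphDerivSq f z * (1 / chordal p q (f z) ^ 2 - 1) := by
  have hg : AnalyticAt ℂ (fun w => q * f w - p) z := by fun_prop
  have hd : deriv (fun w => q * f w - p) z = q * deriv f z := by
    rw [deriv_sub_const, deriv_const_mul _ hf.differentiableAt]
  have h1 := ((HasJet.log_norm_sq hg h0).const_mul (1 / 2)).add
    ((HasJet.log_one_add_norm_sq hf).const_mul (-(1 / 2)))
  have h2 := h1.congr (φ₂ := fun w => Real.log (chordal p q (f w))) (by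
    filter_upwards [hg.continuousAt.eventually_ne h0] with w hw
    have : ‖q * f w - p‖ ≠ 0 := norm_ne_zero_iff.2 hw
    rw [chordal, Real.log_div this (by positivity), Real.log_sqrt (by positivity), Real.log_pow]
    push_cast; ring)
  refine ⟨_, h2.congr_jet ?_, ?_⟩
  · ring
  have hc : ((1 + ‖f z‖ ^ 2 : ℝ) : ℂ) = 1 + f z * starRingEnd ℂ (f z) := by
    rw [Complex.mul_conj, Complex.normSq_eq_norm_sq]; push_cast; rfl
  have hc0 : ((1 + ‖f z‖ ^ 2 : ℝ) : ℂ) ≠ 0 := by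
    exact_mod_cast (show (0 : ℝ) < 1 + ‖f z‖ ^ 2 by positivity).ne'
  have hA : ((1 / 2 : ℝ) : ℂ) * (2 * (deriv (fun w => q * f w - p) z / (q * f z - p)))
      + ((-(1 / 2) : ℝ) : ℂ) * (2 * (starRingEnd ℂ (f z) * deriv f z) / (1 + ‖f z‖ ^ 2 : ℝ))
      = deriv f z * (q + p * starRingEnd ℂ (f z))
        / ((q * f z - p) * (1 + ‖f z‖ ^ 2 : ℝ)) := by
    rw [hd]
    push_cast
    push_cast at hc hc0
    field_simp
    rw [hc]
    ring
  rw [hA, norm_div, norm_mul, norm_mul, Complex.norm_real, Real.norm_of_nonneg (by positivity),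
    div_pow, mul_pow, mul_pow, chordal_sq, sphDerivSq,
    eq_sub_of_add_eq (norm_sq_add_norm_sq_of_unit hpq (f z))]
  have : ‖q * f z - p‖ ≠ 0 := norm_ne_zero_iff.2 h0
  field_simp

/-- The positive term `1 / (4 * s)` of the Laplacian of `s` is what keeps the curvature away from
zero near the cone points. -/
lemma HasJet.chordal (hf : AnalyticAt ℂ f z) (hpq : ‖p‖ ^ 2 + ‖q‖ ^ 2 = 1)
    (h0 : q * f z - p ≠ 0) :
    ∃ A, HasJet (fun w => chordal p q (f w)) z A
      (sphDerivSq f z * (1 / (4 * chordal p q (f z)) - 3 * chordal p q (f z) / 4)) := by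
  obtain ⟨A, hA, hn⟩ := HasJet.log_chordal hf hpq h0
  have hg : ContinuousAt (fun w => q * f w - p) z := by
    have := hf.continuousAt
    fun_prop
  have h1 := hA.exp.congr (φ₂ := fun w => _root_.chordal p q (f w)) (by
    filter_upwards [hg.eventually_ne h0] with w hw
    rw [Real.exp_log (chordal_pos hw)])
  have hpos := chordal_pos h0
  refine ⟨_, h1.congr_jet ?_⟩
  rw [hn, Real.exp_log hpos]
  field_simp
  ring

end

/-! ### A metric of negative curvature with five cone points -/

/-- If any two of the `s i` have sum at least `d`, then at most one of them is smaller than `d / 2`,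
so the product of the inverses is controlled by the largest inverse. -/
lemma prod_inv_le_sum_inv {ι : Type*} [Fintype ι] [Nonempty ι] {s : ι → ℝ}
    {d : ℝ} (hd : 0 < d) (hs : ∀ i, 0 < s i) (h : ∀ i j, i ≠ j → d ≤ s i + s j) :
    ∏ i, (s i)⁻¹ ≤ (2 / d) ^ (Fintype.card ι - 1) * ∑ i, (s i)⁻¹ := by
  classical
  obtain ⟨k, hk⟩ := Finite.exists_min s
  rw [← Finset.mul_prod_erase _ _ (Finset.mem_univ k), mul_comm]
  have hinv : ∀ i, 0 ≤ (s i)⁻¹ := fun i => (inv_pos.2 (hs i)).le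
  refine mul_le_mul ?_ (Finset.single_le_sum (fun i _ => hinv i) (Finset.mem_univ k)) (hinv k)
    (by positivity)
  refine (Finset.prod_le_prod (g := fun _ => 2 / d) (fun i _ => hinv i) fun i hi => ?_).trans_eq ?_
  · have h1 := h i k (Finset.ne_of_mem_erase hi)
    have h2 := hk i
    rw [← inv_div]
    exact inv_anti₀ (by positivity) (by linarith)
  · rw [Finset.prod_const, Finset.card_erase_of_mem (Finset.mem_univ k), Finset.card_univ]

/-- If `f` omits on `G` five distinct points `[p j : q j]` of the sphere, then the pullback by `f` of
a metric of negative curvature with cones of angle `π` at these points is not bounded near all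
points off `G`. -/
theorem false_of_five_ramified {f : ℂ → ℂ} {p q : Fin 5 → ℂ} (hpq : ∀ j, ‖p j‖ ^ 2 + ‖q j‖ ^ 2 = 1)
    (hne : ∀ i j, i ≠ j → p i * q j - p j * q i ≠ 0) {G : Set ℂ} (hG : G ∈ codiscrete ℂ)
    (han : ∀ z ∈ G, AnalyticAt ℂ f z) (hder : ∀ z ∈ G, deriv f z ≠ 0)
    (hval : ∀ z ∈ G, ∀ j, q j * f z - p j ≠ 0)
    (hloc : ∀ j z, ∃ M, ∀ᶠ w in 𝓝[≠] z, sphDerivSq f w / chordal (p j) (q j) (f w) ≤ M) :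
    False := by
  obtain ⟨d, hd, hdle⟩ : ∃ d : ℝ, 0 < d ∧ ∀ i j, i ≠ j → d ≤ ‖p i * q j - p j * q i‖ := by
    obtain ⟨x, hx, hmin⟩ := (Finset.univ : Finset (Fin 5)).offDiag.exists_min_image
      (fun x => ‖p x.1 * q x.2 - p x.2 * q x.1‖) ⟨(0, 1), by simp⟩
    refine ⟨_, norm_pos_iff.2 (hne x.1 x.2 (by simpa using hx)), fun i j hij => ?_⟩
    exact hmin (i, j) (by simpa using hij)
  set C : ℝ := (2 / d) ^ 4 * Real.exp 1 with hC
  have hCpos : 0 < C := by positivity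
  set s : Fin 5 → ℂ → ℝ := fun j w => chordal (p j) (q j) (f w) with hs
  have hspos : ∀ z ∈ G, ∀ j, 0 < s j z := fun z hz j => chordal_pos (hval z hz j)
  have hs1 : ∀ j z, s j z ≤ 1 := fun j z => chordal_le_one (hpq j) _
  -- the factor `2 / 15` balances the error term: `2 / 15 * (3 / 4) * ∑ j, s j` is at most the excess
  -- `5 / 2 - 2` of the curvature
  set u : ℂ → ℝ := fun w => Real.log (‖deriv f w‖ ^ 2) + (-2) * Real.log (1 + ‖f w‖ ^ 2)
    + (-1) * ∑ j, Real.log (s j w) + 2 / 15 * ∑ j, s j w with hu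
  have hexp : ∀ z ∈ G, Real.exp (u z) ≤ C * (sphDerivSq f z * ∑ j, (s j z)⁻¹) := by
    intro z hz
    have h1 : Real.exp (u z)
        = sphDerivSq f z * (∏ j, (s j z)⁻¹) * Real.exp (2 / 15 * ∑ j, s j z) := by
      have hn := norm_pos_iff.2 (hder z hz)
      have e1 : Real.exp (-2 * Real.log (1 + ‖f z‖ ^ 2)) = ((1 + ‖f z‖ ^ 2) ^ 2)⁻¹ := by
        rw [neg_mul, Real.exp_neg, ← Nat.cast_ofNat, ← Real.log_pow, Real.exp_log (by positivity)]
      have e2 : Real.exp (-1 * ∑ j, Real.log (s j z)) = ∏ j, (s j z)⁻¹ := by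
        rw [neg_one_mul, Real.exp_neg, Real.exp_sum, Finset.prod_inv_distrib]
        congr 1
        exact Finset.prod_congr rfl fun j _ => Real.exp_log (hspos z hz j)
      rw [hu, Real.exp_add, Real.exp_add, Real.exp_add, e1, e2, Real.exp_log (by positivity),
        sphDerivSq, div_eq_mul_inv (‖deriv f z‖ ^ 2)]
    have h2 : ∏ j, (s j z)⁻¹ ≤ (2 / d) ^ 4 * ∑ j, (s j z)⁻¹ :=
      prod_inv_le_sum_inv hd (hspos z hz) fun i j hij =>
        (hdle i j hij).trans (norm_sub_le_chordal_add (hpq i) (hpq j) _)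
    have h3 : Real.exp (2 / 15 * ∑ j, s j z) ≤ Real.exp 1 := by
      refine Real.exp_le_exp.2 ?_
      have : ∑ j, s j z ≤ 5 := by
        simpa using Finset.sum_le_card_nsmul Finset.univ (fun j => s j z) 1 fun j _ => hs1 j z
      linarith
    have h4 : 0 ≤ sphDerivSq f z := by unfold sphDerivSq; positivity
    have h5 : 0 ≤ ∑ j, (s j z)⁻¹ :=
      Finset.sum_nonneg fun j _ => (inv_pos.2 (hspos z hz j)).le
    rw [h1]
    calc _ ≤ sphDerivSq f z * ((2 / d) ^ 4 * ∑ j, (s j z)⁻¹) * Real.exp 1 := by gcongr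
      _ = _ := by rw [hC]; ring
  refine false_of_ultrahyperbolic (u := u) hG (κ := 1 / (30 * C)) (by positivity) ?_ ?_
  · intro z hz
    have hf := han z hz
    choose A hA _ using fun j => HasJet.log_chordal hf (hpq j) (hval z hz j)
    choose A' hA' using fun j => HasJet.chordal hf (hpq j) (hval z hz j)
    refine ⟨_, _, (((HasJet.log_norm_sq hf.deriv (hder z hz)).add
      ((HasJet.log_one_add_norm_sq hf).const_mul (-2))).add
      ((HasJet.sum Finset.univ fun j _ => hA j).const_mul (-1))).add
      ((HasJet.sum Finset.univ fun j _ => hA' j).const_mul (2 / 15)), ?_⟩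
    have h0 : 0 ≤ sphDerivSq f z := by unfold sphDerivSq; positivity
    have hK : ∑ j, sphDerivSq f z * (1 / (4 * s j z) - 3 * s j z / 4)
        = sphDerivSq f z * (1 / 4 * ∑ j, (s j z)⁻¹ - 3 / 4 * ∑ j, s j z) := by
      rw [← Finset.mul_sum, Finset.mul_sum _ _ (1 / 4 : ℝ), Finset.mul_sum _ _ (3 / 4 : ℝ),
        ← Finset.sum_sub_distrib]
      congr 1
      refine Finset.sum_congr rfl fun j _ => ?_
      have := (hspos z hz j).ne'
      field_simp
    rw [hK]
    have h5 : ∑ j, s j z ≤ 5 := by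
      simpa using Finset.sum_le_card_nsmul Finset.univ (fun j => s j z) 1 fun j _ => hs1 j z
    calc 1 / (30 * C) * Real.exp (u z)
        ≤ 1 / (30 * C) * (C * (sphDerivSq f z * ∑ j, (s j z)⁻¹)) := by
          gcongr
          exact hexp z hz
      _ = sphDerivSq f z * ∑ j, (s j z)⁻¹ / 30 := by
          rw [← Finset.sum_div]; field_simp
      _ ≤ _ := by
          rw [← Finset.sum_div]
          simp only [Finset.sum_const, Finset.card_univ, Fintype.card_fin, nsmul_eq_mul]
          push_cast
          nlinarith [mul_le_mul_of_nonneg_left h5 h0]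
  · intro z
    choose M hM using fun j => hloc j z
    refine ⟨C * ∑ j, M j, ?_⟩
    filter_upwards [mem_codiscrete_iff_forall_mem_nhdsNE.1 hG z, eventually_all.2 hM] with w hw hMw
    calc u w ≤ Real.exp (u w) := by linarith [Real.add_one_le_exp (u w)]
      _ ≤ _ := hexp w hw
      _ ≤ _ := by
        rw [Finset.mul_sum]
        gcongr with j
        exact hMw j

/-! ### Orders of meromorphic functions -/

lemma meromorphicOrderAt_sub_const_ne_top {f : ℂ → ℂ} (hf : Meromorphic f)
    (hconst : ¬ IsConstantMeromorphic f) (b z : ℂ) :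
    meromorphicOrderAt (fun w => f w - b) z ≠ ⊤ := by
  intro htop
  have hm : MeromorphicOn (fun w => f w - b) Set.univ :=
    fun x _ => (hf x).sub (MeromorphicAt.const b x)
  have hall : ∀ x, meromorphicOrderAt (fun w => f w - b) x = ⊤ := by
    intro x
    by_contra hx
    exact hm.meromorphicOrderAt_ne_top_of_isPreconnected isPreconnected_univ
      (Set.mem_univ x) (Set.mem_univ z) hx htop
  refine hconst ⟨b, mem_codiscrete_iff_forall_mem_nhdsNE.2 fun x => ?_⟩
  filter_upwards [meromorphicOrderAt_eq_top_iff.1 (hall x)] with w hw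
  exact sub_eq_zero.1 hw

/-- A nonconstant meromorphic function has at each point either a pole, or a finite limit `b` which
it takes with finite multiplicity; in both cases the order of the derivative drops by one. -/
lemma exists_order_deriv {f : ℂ → ℂ} (hf : Meromorphic f)
    (hconst : ¬ IsConstantMeromorphic f) (z : ℂ) :
    (∃ n : ℤ, n < 0 ∧ meromorphicOrderAt f z = n ∧
        meromorphicOrderAt (deriv f) z = ↑(n - 1)) ∨
      ∃ (b : ℂ) (n : ℤ), 0 < n ∧ meromorphicOrderAt (fun w => f w - b) z = n ∧
        meromorphicOrderAt (deriv f) z = ↑(n - 1) := by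
  rcases lt_or_ge (meromorphicOrderAt f z) 0 with h | h
  · left
    lift meromorphicOrderAt f z to ℤ using (h.trans_le le_top).ne with n hn
    have hn0 : n < 0 := by exact_mod_cast h
    exact ⟨n, hn0, rfl, meromorphicOrderAt_deriv_eq_sub_one (by exact_mod_cast hn0.ne) hn.symm⟩
  · right
    obtain ⟨b, hb⟩ := tendsto_nhds_of_meromorphicOrderAt_nonneg (hf z) h
    have hm : MeromorphicAt (fun w => f w - b) z := (hf z).sub (MeromorphicAt.const b z)
    have hpos : 0 < meromorphicOrderAt (fun w => f w - b) z := by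
      rw [← tendsto_zero_iff_meromorphicOrderAt_pos hm]
      simpa using hb.sub_const b
    obtain ⟨n, hn⟩ := WithTop.ne_top_iff_exists.1 (meromorphicOrderAt_sub_const_ne_top hf hconst b z)
    rw [← hn] at hpos
    have hn0 : 0 < n := by exact_mod_cast hpos
    refine ⟨b, n, hn0, hn.symm, ?_⟩
    have := meromorphicOrderAt_deriv_eq_sub_one (by exact_mod_cast hn0.ne') hn.symm
    simpa using this

lemma eventually_deriv_ne_zero {f : ℂ → ℂ} (hf : Meromorphic f)
    (hconst : ¬ IsConstantMeromorphic f) (z : ℂ) : ∀ᶠ w in 𝓝[≠] z, deriv f w ≠ 0 := by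
  rw [← meromorphicOrderAt_ne_top_iff_eventually_ne_zero (hf z).deriv]
  rcases exists_order_deriv hf hconst z with ⟨n, -, -, h⟩ | ⟨b, n, -, -, h⟩ <;> simp [h]

lemma exists_eventually_norm_le_of_meromorphicOrderAt_nonneg {h : ℂ → ℂ} {z : ℂ}
    (hm : MeromorphicAt h z) (h0 : 0 ≤ meromorphicOrderAt h z) :
    ∃ M, ∀ᶠ w in 𝓝[≠] z, ‖h w‖ ≤ M := by
  obtain ⟨c, hc⟩ := tendsto_nhds_of_meromorphicOrderAt_nonneg hm h0
  exact ⟨‖c‖ + 1, (hc.norm.eventually_le_const (lt_add_one _))⟩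

lemma meromorphicOrderAt_const_mul_sub {f : ℂ → ℂ} {z p q : ℂ} (hq : q ≠ 0) :
    meromorphicOrderAt (fun w => q * f w - p) z = meromorphicOrderAt (fun w => f w - p / q) z := by
  have : (fun w => q * f w - p) = (fun _ => q) * fun w => f w - p / q := by
    ext w; simp only [Pi.mul_apply]; field_simp
  rw [this, meromorphicOrderAt_mul_of_ne_zero analyticAt_const hq]

/-- The pulled back metric is bounded near a point which is not a simple solution of
`f z = [p : q]`: at a solution of multiplicity `m`, the quotient behaves like
`‖w - z‖ ^ (2 * (m - 1) - m)`. -/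
lemma exists_eventually_sphDerivSq_div_chordal_le {f : ℂ → ℂ} (hf : Meromorphic f)
    (hconst : ¬ IsConstantMeromorphic f) {p q : ℂ} (hpq : ‖p‖ ^ 2 + ‖q‖ ^ 2 = 1) {z : ℂ}
    (hpole : q = 0 → meromorphicOrderAt f z ≠ -1)
    (hzero : q ≠ 0 → meromorphicOrderAt (fun w => f w - p / q) z ≠ 1) :
    ∃ M, ∀ᶠ w in 𝓝[≠] z, sphDerivSq f w / chordal p q (f w) ≤ M := by
  have hmd : MeromorphicAt (deriv f) z := (hf z).deriv
  have hmg : MeromorphicAt (fun w => q * f w - p) z :=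
    ((MeromorphicAt.const q z).mul (hf z)).sub (MeromorphicAt.const p z)
  have hform : ∀ w, sphDerivSq f w / chordal p q (f w)
      = ‖deriv f w‖ ^ 2 / ((√(1 + ‖f w‖ ^ 2)) ^ 3 * ‖q * f w - p‖) := by
    intro w
    have hs : 0 < √(1 + ‖f w‖ ^ 2) := by positivity
    have hsq : 1 + ‖f w‖ ^ 2 = √(1 + ‖f w‖ ^ 2) ^ 2 := (Real.sq_sqrt (by positivity)).symm
    rw [sphDerivSq, chordal]
    nth_rw 1 [hsq]
    field_simp
  -- if `q = 0`, the function `q * f - p` is a nonzero constant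
  have hconst0 : q = 0 → meromorphicOrderAt (fun w => q * f w - p) z = 0 := by
    intro hq
    have hp : p ≠ 0 := by rintro rfl; simp [hq] at hpq
    have : (fun w => q * f w - p) = fun _ => -p := by ext w; simp [hq]
    rw [this, meromorphicOrderAt_const]
    simp [hp]
  rcases exists_order_deriv hf hconst z with ⟨n, hn, hfn, hdn⟩ | ⟨b, n, hn, hfn, hdn⟩
  · obtain ⟨k, hk, hkn⟩ : ∃ k : ℤ, meromorphicOrderAt (fun w => q * f w - p) z = k ∧
        0 ≤ 2 * (n - 1) - (3 * n + k) := by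
      by_cases hq : q = 0
      · refine ⟨0, hconst0 hq, ?_⟩
        have : n ≠ -1 := by
          rintro rfl
          exact hpole hq (by simpa using hfn)
        omega
      · refine ⟨n, ?_, by omega⟩
        rw [meromorphicOrderAt_const_mul_sub hq, ← hfn]
        have h1 : meromorphicOrderAt (fun _ : ℂ => -(p / q)) z ≥ 0 :=
          analyticAt_const.meromorphicOrderAt_nonneg
        have h2 : meromorphicOrderAt f z < meromorphicOrderAt (fun _ : ℂ => -(p / q)) z := by
          refine lt_of_lt_of_le ?_ h1
          rw [hfn]; exact_mod_cast hn
        simpa [sub_eq_add_neg, Pi.add_def] using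
          meromorphicOrderAt_add_eq_left_of_lt (MeromorphicAt.const (-(p / q)) z) h2
    obtain ⟨M, hM⟩ := exists_eventually_norm_le_of_meromorphicOrderAt_nonneg
      (h := deriv f ^ 2 / (f ^ 3 * fun w => q * f w - p)) ((hmd.pow 2).div (((hf z).pow 3).mul hmg))
      (by
        rw [meromorphicOrderAt_div (hmd.pow 2) (((hf z).pow 3).mul hmg), meromorphicOrderAt_pow hmd,
          meromorphicOrderAt_mul ((hf z).pow 3) hmg, meromorphicOrderAt_pow (hf z), hfn, hdn, hk]
        exact WithTop.coe_le_coe.2 hkn)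
    refine ⟨M, ?_⟩
    have hfne : ∀ᶠ w in 𝓝[≠] z, f w ≠ 0 :=
      (meromorphicOrderAt_ne_top_iff_eventually_ne_zero (hf z)).1 (by simp [hfn])
    have hgne : ∀ᶠ w in 𝓝[≠] z, q * f w - p ≠ 0 :=
      (meromorphicOrderAt_ne_top_iff_eventually_ne_zero hmg).1 (by simp [hk])
    filter_upwards [hM, hfne, hgne] with w hw hfw hgw
    refine le_trans ?_ hw
    have h1 := norm_pos_iff.2 hfw
    have h2 := norm_pos_iff.2 hgw
    rw [hform]
    simp only [Pi.div_apply, Pi.mul_apply, Pi.pow_apply, norm_div, norm_mul, norm_pow]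
    gcongr
    exact Real.le_sqrt_of_sq_le (by linarith)
  · obtain ⟨k, hk, hkn⟩ : ∃ k : ℤ, meromorphicOrderAt (fun w => q * f w - p) z = k ∧
        0 ≤ 2 * (n - 1) - k := by
      by_cases hq : q = 0
      · exact ⟨0, hconst0 hq, by omega⟩
      · by_cases hb : p / q = b
        · refine ⟨n, by rw [meromorphicOrderAt_const_mul_sub hq, hb, hfn], ?_⟩
          have : n ≠ 1 := by
            rintro rfl
            exact hzero hq (by rw [hb]; simpa using hfn)
          omega
        · refine ⟨0, ?_, by omega⟩
          rw [meromorphicOrderAt_const_mul_sub hq]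
          have h0 : b - p / q ≠ 0 := sub_ne_zero.2 (Ne.symm hb)
          have h1 : meromorphicOrderAt (fun _ : ℂ => b - p / q) z = 0 := by
            rw [meromorphicOrderAt_const]; simp [h0]
          have h2 : meromorphicOrderAt (fun _ : ℂ => b - p / q) z
              < meromorphicOrderAt (fun w => f w - b) z := by
            rw [h1, hfn]; exact_mod_cast hn
          have h3 := meromorphicOrderAt_add_eq_left_of_lt
            ((hf z).sub (MeromorphicAt.const b z)) h2
          rw [h1] at h3
          rw [← WithTop.coe_zero] at h3
          convert h3 using 2
          ext w
          simp
    obtain ⟨M, hM⟩ := exists_eventually_norm_le_of_meromorphicOrderAt_nonneg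
      (h := deriv f ^ 2 / fun w => q * f w - p) ((hmd.pow 2).div hmg)
      (by
        rw [meromorphicOrderAt_div (hmd.pow 2) hmg, meromorphicOrderAt_pow hmd, hdn, hk]
        exact WithTop.coe_le_coe.2 hkn)
    refine ⟨M, ?_⟩
    have hgne : ∀ᶠ w in 𝓝[≠] z, q * f w - p ≠ 0 :=
      (meromorphicOrderAt_ne_top_iff_eventually_ne_zero hmg).1 (by simp [hk])
    filter_upwards [hM, hgne] with w hw hgw
    refine le_trans ?_ hw
    have h2 := norm_pos_iff.2 hgw
    rw [hform]
    simp only [Pi.div_apply, Pi.pow_apply, norm_div, norm_pow]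
    gcongr
    have h3 : 1 ≤ √(1 + ‖f w‖ ^ 2) := Real.one_le_sqrt.2 (by linarith [sq_nonneg ‖f w‖])
    exact le_mul_of_one_le_left h2.le (one_le_pow₀ h3)

lemma exists_unit_coords (a : OnePoint ℂ) :
    ∃ p q : ℂ, ‖p‖ ^ 2 + ‖q‖ ^ 2 = 1 ∧
      ((q = 0 ∧ a = ∞) ∨ (q ≠ 0 ∧ a = ((p / q : ℂ) : OnePoint ℂ))) := by
  induction a using OnePoint.rec with
  | infty => exact ⟨1, 0, by simp, Or.inl ⟨rfl, rfl⟩⟩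
  | coe b =>
    have hpos : 0 < √(1 + ‖b‖ ^ 2) := by positivity
    have hne : ((√(1 + ‖b‖ ^ 2) : ℝ) : ℂ) ≠ 0 := by exact_mod_cast hpos.ne'
    refine ⟨b / (√(1 + ‖b‖ ^ 2) : ℝ), 1 / (√(1 + ‖b‖ ^ 2) : ℝ), ?_, Or.inr ⟨by simpa using hne, ?_⟩⟩
    · rw [norm_div, norm_div, Complex.norm_real, Real.norm_of_nonneg hpos.le, norm_one, div_pow,
        div_pow, Real.sq_sqrt (by positivity)]
      field_simp
      ring
    · congr 1
      field_simp

/-! ### Five totally ramified values -/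

theorem mainTheorem4 (f : ℂ → ℂ) (hf : Meromorphic f) (hconst : ¬ IsConstantMeromorphic f)
    (a : Fin 5 → OnePoint ℂ) (ha : Function.Injective a) :
    ∃ j : Fin 5, ∃ z : ℂ, IsSimpleSolution f (a j) z := by
  by_contra! hns
  choose p q hpq hcase using fun j => exists_unit_coords (a j)
  refine false_of_five_ramified (f := f) hpq (fun i j hij h => ?_)
    (G := {z | AnalyticAt ℂ f z ∧ deriv f z ≠ 0 ∧ ∀ j, q j * f z - p j ≠ 0})
    (mem_codiscrete_iff_forall_mem_nhdsNE.2 fun z => ?_)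
    (fun z hz => hz.1) (fun z hz => hz.2.1) (fun z hz => hz.2.2) (fun j z => ?_)
  · have hp0 : ∀ j, q j = 0 → p j ≠ 0 := fun j hq hp => by simpa [hp, hq] using hpq j
    rw [sub_eq_zero] at h
    refine hij (ha ?_)
    rcases hcase i with ⟨hi, hai⟩ | ⟨hi, hai⟩ <;> rcases hcase j with ⟨hj, haj⟩ | ⟨hj, haj⟩
    · rw [hai, haj]
    · simp [hi, hj, hp0 i hi] at h
    · simp [hi, hj, hp0 j hj] at h
    · rw [hai, haj, (div_eq_div_iff hi hj).2 h]
  · have hval : ∀ j, ∀ᶠ w in 𝓝[≠] z, q j * f w - p j ≠ 0 := by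
      intro j
      rcases hcase j with ⟨hq, -⟩ | ⟨hq, -⟩
      · have hp : p j ≠ 0 := fun hp => by simpa [hp, hq] using hpq j
        exact Eventually.of_forall fun w => by simp [hq, hp]
      · have hm : MeromorphicAt (fun w => q j * f w - p j) z :=
          ((MeromorphicAt.const (q j) z).mul (hf z)).sub (MeromorphicAt.const (p j) z)
        rw [← meromorphicOrderAt_ne_top_iff_eventually_ne_zero hm]
        exact (meromorphicOrderAt_const_mul_sub hq).trans_ne
          (meromorphicOrderAt_sub_const_ne_top hf hconst _ z)
    filter_upwards [(hf z).eventually_analyticAt, eventually_deriv_ne_zero hf hconst z,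
      eventually_all.2 hval] with w h1 h2 h3
    exact ⟨h1, h2, h3⟩
  · refine exists_eventually_sphDerivSq_div_chordal_le hf hconst (hpq j) (fun hq hord => ?_)
      fun hq hord => ?_
    · rcases hcase j with ⟨-, haj⟩ | ⟨hq', -⟩
      · have := hns j z
        rw [haj] at this
        exact this hord
      · exact hq' hq
    · rcases hcase j with ⟨hq', -⟩ | ⟨-, haj⟩
      · exact hq hq'
      · have := hns j z
        rw [haj] at this
        exact this hord
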